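/- **Setting.** Let $G_2$ be the group of the $2\times2\times2$ Rubik's cube: the group of permutations of its 24 stickers generated by the clockwise quarter turns $u_2,d_2,f_2,b_2,l_2,r_2$ of the six faces. Let $G_3$ be the group of the $3\times3\times3$ cube: the group of permutations of its 54 stickers generated by the six clockwise quarter turns $u_3,d_3,f_3,b_3,l_3,r_3$ of the faces. Restricting an element of $G_3$ to the stickers of the corner pieces gives a homomorphism $\psi:G_3\to G_2$, which sends $u_3\mapsto u_2$, …, $r_3\mapsto r_2$. Let $\alpha:G_3\to S_{12}\times S_8$ record the permutations of the 12 edge positions and of the 8 corner positions, and put $P=\alpha(G_3)$. Let $L\trianglelefteq G_3$ be the group of corner twists, i.e. of the elements that leave every corner piece in its position and act trivially on the edge pieces. At each corner position choose one of the three right-handed bases formed by the outward normals of the three stickers there, and at each edge position one of the two bases formed by the normals of the two stickers there; let $Q\le G_3$ be the subgroup of moves that preserve local orientation, i.e. that carry, for each piece, the basis at its old position to the basis at its new position. Let $b$ and $c$ be the top-right and top-front edge positions, let $\sigma:S_8\to S_{12}$ be the homomorphism sending even permutations to $1$ and odd permutations to the transposition $(b\,c)$, and put $S=\{(\sigma(p),p):p\in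 S_8\}\le S_{12}\times S_8$. **Theorem.** For every choice of the bases, $S\subseteq P$, and there is exactly one homomorphism $\tau:S\to G_3$ with $\tau(p)\in Q$ and $\alpha(\tau(p))=p$ for all $p\in S$. Let $S$ act on $L$ by conjugation through $\tau$. Then $(l,p)\mapsto l\,\tau(p)$ is an injective homomorphism $L\rtimes S\to G_3$, and $\psi$ maps its image, the subgroup $L\rtimes S$ of $G_3$, isomorphically onto $G_2$. Hence there is a homomorphism $s:G_2\to G_3$ with $\psi\circ s=\mathrm{id}_{G_2}$ and $s(G_2)=L\rtimes S$; this $s$ is injective. So $\psi$ splits, and $G_2$ embeds in $G_3$. -/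

import Mathlib

namespace RubiksCube

open Equiv Function

theorem perm_apply_inv {α : Type*} (e : Perm α) (x : α) : e (e⁻¹ x) = x := e.apply_symm_apply x

theorem perm_inv_apply {α : Type*} (e : Perm α) (x : α) : e⁻¹ (e x) = x := e.symm_apply_apply x

/-! ### Faces and quarter turns of the solid cube -/

/-- The six faces of the cube. -/
inductive Face
  | U | D | F | B | L | R
  deriving DecidableEq

open Face

instance : Fintype Face := ⟨{U, D, F, B, L, R}, by intro x; cases x <;> decide⟩

/-- Outward unit normal of a face; the axes point right, back, up (a right-handed system). -/
def normal : Face → Fin 3 → ℤ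
  | U => ![0, 0, 1]
  | D => ![0, 0, -1]
  | F => ![0, -1, 0]
  | B => ![0, 1, 0]
  | L => ![-1, 0, 0]
  | R => ![1, 0, 0]

/-- `spin X Y` is the face to which the face `Y` is carried by the rotation of space by 90 degrees
about the axis of `X`, clockwise for an observer outside the cube looking at `X`. -/
def spin : Face → Face → Face
  | U, F => L | U, L => B | U, B => R | U, R => F
  | D, F => R | D, R => B | D, B => L | D, L => F
  | F, U => R | F, R => D | F, D => L | F, L => U
  | B, U => L | B, L => D | B, D => R | B, R => U
  | L, U => F | L, F => D | L, D => B | L, B => U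
  | R, U => B | R, B => D | R, D => F | R, F => U
  | _, Y => Y

/-- `spin X` is the clockwise quarter turn about `normal X`:
`v ↦ v × n + (v ⬝ n) n` with `n = normal X`. -/
theorem normal_spin (X Y : Face) :
    normal (spin X Y) =
      crossProduct (normal Y) (normal X) + (normal Y ⬝ᵥ normal X) • normal X := by
  revert X Y; decide

/-! ### Stickers -/

/-- A corner sticker `(i, k)`: the sticker number `k` at the corner position `i`. -/
abbrev CornerSticker := Fin 8 × ZMod 3

/-- An edge sticker `(x, k)`: the sticker number `k` at the edge position `x`. -/
abbrev EdgeSticker := Fin 12 × ZMod 2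

/-- The stickers of the `3 × 3` cube: corner stickers, edge stickers, and one centre sticker on
each face. The stickers of the `2 × 2` cube are the corner stickers. -/
abbrev Sticker := CornerSticker ⊕ (EdgeSticker ⊕ Face)

/-- The face on which a corner sticker place lies. Positions `0, …, 7` are top-front-left,
top-front-right, top-back-left, top-back-right, bottom-front-left, bottom-front-right,
bottom-back-left, bottom-back-right. The three stickers at a position are listed counterclockwise
as seen from outside, so `k ↦ k + 1` is a counterclockwise rotation by `2π/3`. -/
def cornerFace : CornerSticker → Face := fun s =>
  (![![U, L, F], ![U, F, R], ![U, B, L], ![U, R, B],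
     ![D, F, L], ![D, R, F], ![D, L, B], ![D, B, R]] : Fin 8 → Fin 3 → Face) s.1 s.2

/-- The face on which an edge sticker place lies. Positions `0, …, 11` (the letters `a, …, l`) are
top-back, top-right, top-front, top-left, back-left, back-right, front-right, front-left,
bottom-back, bottom-right, bottom-front, bottom-left. -/
def edgeFace : EdgeSticker → Face := fun s =>
  (![![U, B], ![U, R], ![U, F], ![U, L], ![B, L], ![B, R],
     ![F, R], ![F, L], ![D, B], ![D, R], ![D, F], ![D, L]] : Fin 12 → Fin 2 → Face) s.1 s.2

/-- The normals of the stickers at a corner, in the order listed, form a right-handed basis;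
this is the counterclockwise order seen from outside. -/
theorem cornerFace_rightHanded (i : Fin 8) :
    normal (cornerFace (i, 0)) ⬝ᵥ
      crossProduct (normal (cornerFace (i, 1))) (normal (cornerFace (i, 2))) = 1 := by
  revert i; decide

/-! ### The moves -/

/-- The permutation of sticker places that carries the cubelet at position `i` to position `π i`,
with sticker number `k` going to sticker number `k + t i`. -/
def twistPerm {ι A : Type*} [AddGroup A] (π : Perm ι) (t : ι → A) : Perm (ι × A) where
  toFun s := (π s.1, s.2 + t s.1)
  invFun s := (π.symm s.1, s.2 - t (π.symm s.1))
  left_inv s := by simp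
  right_inv s := by simp

/-- The permutation of the corner positions made by the clockwise quarter turn of a face. -/
def cornerCycle : Face → Perm (Fin 8)
  | U => List.formPerm [0, 2, 3, 1]
  | D => List.formPerm [4, 5, 7, 6]
  | F => List.formPerm [0, 1, 5, 4]
  | B => List.formPerm [2, 6, 7, 3]
  | L => List.formPerm [0, 4, 6, 2]
  | R => List.formPerm [1, 3, 7, 5]

/-- The shift of the sticker numbers of the corner cubelet coming from each position. -/
def cornerTwist : Face → Fin 8 → ZMod 3
  | U => 0
  | D => 0
  | F => ![2, 1, 0, 0, 1, 2, 0, 0]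
  | B => ![0, 0, 1, 2, 0, 0, 2, 1]
  | L => ![1, 0, 2, 0, 2, 0, 1, 0]
  | R => ![0, 2, 0, 1, 0, 1, 0, 2]

/-- The permutation of the edge positions made by the clockwise quarter turn of a face. -/
def edgeCycle : Face → Perm (Fin 12)
  | U => List.formPerm [0, 1, 2, 3]
  | D => List.formPerm [8, 11, 10, 9]
  | F => List.formPerm [2, 6, 10, 7]
  | B => List.formPerm [0, 4, 8, 5]
  | L => List.formPerm [3, 7, 11, 4]
  | R => List.formPerm [1, 5, 9, 6]

/-- The shift of the sticker numbers of the edge cubelet coming from each position. -/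
def edgeTwist : Face → Fin 12 → ZMod 2
  | U => 0
  | D => 0
  | F => ![0, 0, 1, 0, 0, 0, 1, 1, 0, 0, 1, 0]
  | B => ![1, 0, 0, 0, 1, 1, 0, 0, 1, 0, 0, 0]
  | L => 0
  | R => 0

/-- The permutation of the corner stickers made by the clockwise quarter turn of a face. -/
def cornerTurn (X : Face) : Perm CornerSticker := twistPerm (cornerCycle X) (cornerTwist X)

/-- The permutation of the edge stickers made by the clockwise quarter turn of a face. -/
def edgeTurn (X : Face) : Perm EdgeSticker := twistPerm (edgeCycle X) (edgeTwist X)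

/-- `cornerTurn X` is the geometric quarter turn: a corner cubelet that has a sticker on the face
`X` is rotated as a rigid body by `spin X`; the other corner cubelets do not move. -/
theorem cornerTurn_geometric (X : Face) (i : Fin 8) (k : ZMod 3) :
    ((∃ m, cornerFace (i, m) = X) →
      ∀ m, cornerFace ((cornerTurn X (i, k)).1, (cornerTurn X (i, k)).2 + m) =
        spin X (cornerFace (i, k + m))) ∧
    ((∀ m, cornerFace (i, m) ≠ X) → cornerTurn X (i, k) = (i, k)) := by
  revert X i k; decide +kernel

/-- `edgeTurn X` is the geometric quarter turn: an edge cubelet that has a sticker on the face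
`X` is rotated as a rigid body by `spin X`; the other edge cubelets do not move. -/
theorem edgeTurn_geometric (X : Face) (i : Fin 12) (k : ZMod 2) :
    ((∃ m, edgeFace (i, m) = X) →
      ∀ m, edgeFace ((edgeTurn X (i, k)).1, (edgeTurn X (i, k)).2 + m) =
        spin X (edgeFace (i, k + m))) ∧
    ((∀ m, edgeFace (i, m) ≠ X) → edgeTurn X (i, k) = (i, k)) := by
  revert X i k; decide +kernel

/-- A permutation of the corner stickers and one of the edge stickers, put together to a
permutation of all stickers that fixes the centres. -/
def assemble : Perm CornerSticker × Perm EdgeSticker →* Perm Sticker where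
  toFun g := Equiv.sumCongr g.1 (Equiv.sumCongr g.2 (1 : Perm Face))
  map_one' := by ext s; rcases s with s | s | s <;> rfl
  map_mul' g h := by ext s; rcases s with s | s | s <;> rfl

theorem assemble_injective : Injective assemble := by
  intro g h e
  refine Prod.ext (Equiv.ext fun s => ?_) (Equiv.ext fun s => ?_)
  · exact Sum.inl_injective (congrArg (fun f : Perm Sticker => f (Sum.inl s)) e)
  · exact Sum.inl_injective (Sum.inr_injective
      (congrArg (fun f : Perm Sticker => f (Sum.inr (Sum.inl s))) e))

/-- The quarter turn of a face, as a permutation of the stickers of the `3 × 3` cube. -/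
def turn (X : Face) : Perm Sticker := assemble (cornerTurn X, edgeTurn X)

/-- The group of the `2 × 2` cube, generated by the six quarter turns. -/
def G2 : Subgroup (Perm CornerSticker) := Subgroup.closure (Set.range cornerTurn)

/-- The group of the `3 × 3` cube, generated by the six quarter turns. -/
def G3 : Subgroup (Perm Sticker) := Subgroup.closure (Set.range turn)

/-! ### Restriction to corner stickers and to edge stickers -/

theorem G3_le_range : G3 ≤ assemble.range := by
  rw [G3, Subgroup.closure_le]
  rintro _ ⟨X, rfl⟩
  exact ⟨_, rfl⟩

/-- The pair of permutations that an element of `G3` induces on corner and edge stickers. -/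
noncomputable def components : G3 →* Perm CornerSticker × Perm EdgeSticker :=
  (MonoidHom.ofInjective assemble_injective).symm.toMonoidHom.comp (Subgroup.inclusion G3_le_range)

theorem assemble_components (g : G3) : assemble (components g) = g :=
  congrArg Subtype.val ((MonoidHom.ofInjective assemble_injective).apply_symm_apply
    (Subgroup.inclusion G3_le_range g))

/-- The permutation that an element of `G3` induces on the corner stickers. -/
noncomputable def cornerAction : G3 →* Perm CornerSticker :=
  (MonoidHom.fst _ _).comp components

/-- The permutation that an element of `G3` induces on the edge stickers. -/
noncomputable def edgeAction : G3 →* Perm EdgeSticker :=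
  (MonoidHom.snd _ _).comp components

theorem coe_inl (g : G3) (s : CornerSticker) :
    (g : Perm Sticker) (Sum.inl s) = Sum.inl (cornerAction g s) := by
  conv_lhs => rw [← assemble_components g]
  rfl

theorem coe_inr_inl (g : G3) (s : EdgeSticker) :
    (g : Perm Sticker) (Sum.inr (Sum.inl s)) = Sum.inr (Sum.inl (edgeAction g s)) := by
  conv_lhs => rw [← assemble_components g]
  rfl

theorem components_eq_of_assemble {g : G3} {c : Perm CornerSticker × Perm EdgeSticker}
    (h : (g : Perm Sticker) = assemble c) : components g = c :=
  assemble_injective ((assemble_components g).trans h)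

theorem components_mem (g : G3) :
    components g ∈ Subgroup.closure (Set.range fun X => (cornerTurn X, edgeTurn X)) := by
  have h : G3 = (Subgroup.closure (Set.range fun X => (cornerTurn X, edgeTurn X))).map
      assemble := by
    rw [MonoidHom.map_closure, ← Set.range_comp]
    rfl
  obtain ⟨c, hc, hg⟩ := Subgroup.mem_map.1 (h.le g.2)
  rwa [components_eq_of_assemble hg.symm]

theorem cornerAction_mem (g : G3) : cornerAction g ∈ G2 := by
  have h := Subgroup.mem_map_of_mem (MonoidHom.fst _ _) (components_mem g)
  rw [MonoidHom.map_closure, ← Set.range_comp] at h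
  exact h

theorem edgeAction_mem (g : G3) : edgeAction g ∈ Subgroup.closure (Set.range edgeTurn) := by
  have h := Subgroup.mem_map_of_mem (MonoidHom.snd _ _) (components_mem g)
  rw [MonoidHom.map_closure, ← Set.range_comp] at h
  exact h

/-- The homomorphism `ψ : G3 → G2` that forgets the edges (and the centres). -/
noncomputable def psi : G3 →* G2 := cornerAction.codRestrict G2 cornerAction_mem

/-- `ψ` sends each generator of `G3` to the like generator of `G2`. -/
theorem psi_turn (X : Face) :
    psi ⟨turn X, Subgroup.subset_closure ⟨X, rfl⟩⟩ =
      ⟨cornerTurn X, Subgroup.subset_closure ⟨X, rfl⟩⟩ :=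
  Subtype.ext (congrArg Prod.fst (components_eq_of_assemble
    (g := ⟨turn X, Subgroup.subset_closure ⟨X, rfl⟩⟩) (c := (cornerTurn X, edgeTurn X)) rfl))

/-! ### Permutations of the positions -/

/-- The sticker permutations that keep the stickers of each cubelet together. -/
def cubeletPerms (ι A : Type*) : Subgroup (Perm (ι × A)) where
  carrier := {g | ∀ x y, (g x).1 = (g y).1 ↔ x.1 = y.1}
  one_mem' _ _ := Iff.rfl
  mul_mem' {g h} hg hh x y := (hg (h x) (h y)).trans (hh x y)
  inv_mem' {g} hg x y := by
    have := hg (g⁻¹ x) (g⁻¹ y)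
    rw [perm_apply_inv, perm_apply_inv] at this
    exact this.symm

/-- The permutation of the positions induced by a permutation of the stickers that keeps the
stickers of each cubelet together. -/
def positionHom (ι A : Type*) [Zero A] : cubeletPerms ι A →* Perm ι where
  toFun g :=
    { toFun := fun i => (g.1 (i, 0)).1
      invFun := fun i => (g.1⁻¹ (i, 0)).1
      left_inv := fun i => by
        have := ((cubeletPerms ι A).inv_mem g.2 ((g.1 (i, 0)).1, 0) (g.1 (i, 0))).2 rfl
        rw [perm_inv_apply] at this
        exact this
      right_inv := fun i => by
        have := (g.2 ((g.1⁻¹ (i, 0)).1, 0) (g.1⁻¹ (i, 0))).2 rfl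
        rw [perm_apply_inv] at this
        exact this }
  map_one' := rfl
  map_mul' g h := Equiv.ext fun i => (g.2 (h.1 (i, 0)) ((h.1 (i, 0)).1, 0)).2 rfl

theorem positionHom_apply {ι A : Type*} [Zero A] (g : cubeletPerms ι A) (x : ι × A) :
    positionHom ι A g x.1 = (g.1 x).1 :=
  (g.2 (x.1, 0) x).2 rfl

theorem twistPerm_mem {ι A : Type*} [AddGroup A] (π : Perm ι) (t : ι → A) :
    twistPerm π t ∈ cubeletPerms ι A :=
  fun _ _ => π.injective.eq_iff

theorem G2_le_cubeletPerms : G2 ≤ cubeletPerms (Fin 8) (ZMod 3) := by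
  rw [G2, Subgroup.closure_le]
  rintro _ ⟨X, rfl⟩
  exact twistPerm_mem _ _

theorem edgeAction_mem_cubeletPerms (g : G3) :
    edgeAction g ∈ cubeletPerms (Fin 12) (ZMod 2) := by
  refine (Subgroup.closure_le _).2 ?_ (edgeAction_mem g)
  rintro _ ⟨X, rfl⟩
  exact twistPerm_mem _ _

/-- The homomorphism `φ : G2 → S₈` recording the permutation of the corner positions. -/
def phi : G2 →* Perm (Fin 8) :=
  (positionHom (Fin 8) (ZMod 3)).comp (Subgroup.inclusion G2_le_cubeletPerms)

/-- The homomorphism `β : G3 → S₁₂` recording the permutation of the edge positions. -/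
noncomputable def beta : G3 →* Perm (Fin 12) :=
  (positionHom (Fin 12) (ZMod 2)).comp
    (edgeAction.codRestrict (cubeletPerms (Fin 12) (ZMod 2)) edgeAction_mem_cubeletPerms)

/-- The homomorphism `α : G3 → S₁₂ × S₈` recording the permutations of the edge positions and of
the corner positions. -/
noncomputable def alpha : G3 →* Perm (Fin 12) × Perm (Fin 8) := beta.prod (phi.comp psi)

/-- The group `L` of corner twists: the elements of `G3` that leave every corner cubelet in its
position and fix every edge sticker. -/
noncomputable def cornerTwists : Subgroup G3 := (phi.comp psi).ker ⊓ edgeAction.ker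

instance cornerTwists_normal : cornerTwists.Normal :=
  inferInstanceAs ((phi.comp psi).ker ⊓ edgeAction.ker).Normal

/-! ### Local orientation -/

/-- A choice of a basis for local orientation at each position. At a corner it is a right-handed
basis formed by the outward normals of the three stickers, at an edge a basis formed by the
normals of the two stickers; such a basis is determined by the sticker place that carries its
first vector, and `corner i`, `edge x` are the numbers of this place. -/
structure LocalFrame where
  corner : Fin 8 → ZMod 3
  edge : Fin 12 → ZMod 2

/-- Local orientation at the corner position `j` after the move `g`: the number of counterclockwise
rotations by `2π/3` that take the basis of the solved state at `j` to the basis carried there by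
the cubelet now at `j` (which comes from position `i`). -/
noncomputable def cornerOrientation (o : LocalFrame) (g : G3) (j : Fin 8) : ZMod 3 :=
  let i := (alpha g).2⁻¹ j
  (cornerAction g (i, o.corner i)).2 - o.corner j

/-- Local orientation at the edge position `y` after the move `g`. -/
noncomputable def edgeOrientation (o : LocalFrame) (g : G3) (y : Fin 12) : ZMod 2 :=
  let x := (alpha g).1⁻¹ y
  (edgeAction g (x, o.edge x)).2 - o.edge y

theorem alpha_snd_apply (g : G3) (s : CornerSticker) :
    (alpha g).2 s.1 = (cornerAction g s).1 :=
  positionHom_apply (Subgroup.inclusion G2_le_cubeletPerms (psi g)) s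

theorem alpha_fst_apply (g : G3) (s : EdgeSticker) :
    (alpha g).1 s.1 = (edgeAction g s).1 :=
  positionHom_apply (edgeAction.codRestrict _ edgeAction_mem_cubeletPerms g) s

theorem cornerOrientation_eq_zero_iff (o : LocalFrame) (g : G3) :
    (∀ j, cornerOrientation o g j = 0) ↔
      ∀ i, cornerAction g (i, o.corner i) = ((alpha g).2 i, o.corner ((alpha g).2 i)) := by
  refine ((alpha g).2.forall_congr_right
    (q := fun j => cornerOrientation o g j = 0)).symm.trans (forall_congr' fun i => ?_)
  simp only [cornerOrientation, perm_inv_apply, sub_eq_zero]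
  exact ⟨fun h => Prod.ext (alpha_snd_apply g (i, _)).symm h, fun h => congrArg Prod.snd h⟩

theorem edgeOrientation_eq_zero_iff (o : LocalFrame) (g : G3) :
    (∀ y, edgeOrientation o g y = 0) ↔
      ∀ x, edgeAction g (x, o.edge x) = ((alpha g).1 x, o.edge ((alpha g).1 x)) := by
  refine ((alpha g).1.forall_congr_right
    (q := fun y => edgeOrientation o g y = 0)).symm.trans (forall_congr' fun i => ?_)
  simp only [edgeOrientation, perm_inv_apply, sub_eq_zero]
  exact ⟨fun h => Prod.ext (alpha_fst_apply g (i, _)).symm h, fun h => congrArg Prod.snd h⟩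

/-- The group `Q` of moves preserving local orientation at every corner and every edge. -/
noncomputable def orientationPreserving (o : LocalFrame) : Subgroup G3 where
  carrier := {g | (∀ j, cornerOrientation o g j = 0) ∧ ∀ y, edgeOrientation o g y = 0}
  one_mem' := by
    simp [cornerOrientation_eq_zero_iff, edgeOrientation_eq_zero_iff]
  mul_mem' {g h} hg hh := by
    simp only [Set.mem_ofPred_eq, cornerOrientation_eq_zero_iff,
      edgeOrientation_eq_zero_iff] at hg hh ⊢
    simp [hg.1, hg.2, hh.1, hh.2]
  inv_mem' {g} hg := by
    simp only [Set.mem_ofPred_eq, cornerOrientation_eq_zero_iff,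
      edgeOrientation_eq_zero_iff] at hg ⊢
    constructor
    · intro i
      have := hg.1 ((alpha g).2⁻¹ i)
      rw [perm_apply_inv] at this
      rw [map_inv, map_inv, Perm.inv_eq_iff_eq, Prod.snd_inv, this]
    · intro i
      have := hg.2 ((alpha g).1⁻¹ i)
      rw [perm_apply_inv] at this
      rw [map_inv, map_inv, Perm.inv_eq_iff_eq, Prod.fst_inv, this]

/-! ### The complement of the corner twists -/

/-- The sign map `σ : S₈ → {1, (b c)} ⊆ S₁₂`; the edge positions `b`, `c` are `1`, `2`. -/
def sigma : Perm (Fin 8) →* Perm (Fin 12) where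
  toFun p := if Perm.sign p = 1 then 1 else Equiv.swap 1 2
  map_one' := by simp
  map_mul' p q := by
    rcases Int.units_eq_one_or (Perm.sign p) with hp | hp <;>
      rcases Int.units_eq_one_or (Perm.sign q) with hq | hq <;> simp [hp, hq]

/-- The subgroup `S = {(σ(p), p)}` of `S₁₂ × S₈`. -/
def S : Subgroup (Perm (Fin 12) × Perm (Fin 8)) := (sigma.prod (MonoidHom.id _)).range

/-- `τ` realizes the elements of `S` by moves of the cube that preserve local orientation, i.e. it
is the restriction to `S` of the inverse of the injective map `α|_Q`. -/
def IsOrientedLift (o : LocalFrame) (τ : S →* G3) : Prop :=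
  ∀ p : S, τ p ∈ orientationPreserving o ∧ alpha (τ p) = p

/-- Given a realization `τ` of `S` in `G3`, the semidirect product `L ⋊ S` (where `S` acts on `L`
by conjugation through `τ`) with its canonical homomorphism `(l, p) ↦ l * τ p` to `G3`. -/
noncomputable def semidirectHom (τ : S →* G3) :
    cornerTwists ⋊[(MulAut.conjNormal (H := cornerTwists)).comp τ] S →* G3 :=
  SemidirectProduct.lift cornerTwists.subtype τ fun _ => by ext1; simp

end RubiksCube

namespace RubiksCube

open Equiv Function Face

/-! Two facts about the corners carry the proof. Every element of `G2` permutes the corner cubelets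
with total twist zero (`G2_le_zeroTwist`). Conversely, every even corner permutation with any twist
vector of sum zero is realized by a move fixing all edges (`twistPerm_mem_pairGroup`): conjugates of
one 3-cycle and of one two-corner twist suffice, because the group induces all of `S₈` on the
corners.

A move in `Q` is determined by its position permutations, so `τ` must be `frameLift` on both kinds
of stickers. Its twist `o ∘ π - o` sums to zero, so for even `p` the lift is a move. For odd `p` one
also needs a move swapping the edges `b`, `c`, unflipped or flipped according to whether the two
edge bases have equal numbers; the corners are then corrected by an even move
(`frameLift_mem_pairGroup`).

Finally, `L` meets the kernel of `ψ` trivially and is mapped by `ψ` onto the kernel of `φ`, while `φ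
∘ ψ ∘ τ` is the bijection `S → S₈`. Hence `ψ` is bijective on `L ⋊ S`. -/

/-! ### Words in the quarter turns -/

/-- The quarter turn of a face, as a pair of permutations of the corner and the edge stickers. -/
def pairTurn (X : Face) : Perm CornerSticker × Perm EdgeSticker := (cornerTurn X, edgeTurn X)

/-- The group generated by the pairs `pairTurn X`; it is mapped onto `G3` by `assemble`. -/
def pairGroup : Subgroup (Perm CornerSticker × Perm EdgeSticker) :=
  Subgroup.closure (Set.range pairTurn)

theorem pairTurn_mem (X : Face) : pairTurn X ∈ pairGroup := Subgroup.subset_closure ⟨X, rfl⟩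

theorem wordPow_mem (w : List Face) (n : ℕ) : (w.map pairTurn).prod ^ n ∈ pairGroup := by
  refine pow_mem (list_prod_mem fun g hg => ?_) n
  obtain ⟨X, -, rfl⟩ := List.mem_map.1 hg
  exact pairTurn_mem X

/-- The word is the commutator of `L` with `U⁻¹R⁻¹U`. The exponent 1 fits the shape of
`wordPow_mem`. -/
theorem threeCycle_word :
    ([L, U, U, U, R, R, R, U, L, L, L, U, U, U, R, U].map pairTurn).prod ^ 1 =
      (twistPerm (swap 0 2 * swap 0 3) (Pi.single 0 2 + Pi.single 3 2 + Pi.single 2 2), 1) := by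
  decide +kernel

/-- The word is `R⁻¹U²RUR⁻¹UR` times its left-right mirror image. -/
theorem twist_word :
    ([R, R, R, U, U, R, U, R, R, R, U, R, L, U, U, L, L, L, U, U, U, L, U, U, U, L, L, L].map
        pairTurn).prod ^ 1 = (twistPerm 1 (Pi.single 1 2 + Pi.single 3 1), 1) := by
  decide +kernel

/-- With `swap_word`, this gives both ways of exchanging the edges `b` and `c`, with and without a
flip; in both the corner permutation is odd. -/
theorem flippedSwap_word :
    ([F, U, U, L, B, F, U, R, U].map pairTurn).prod ^ 9 =
      (twistPerm (swap 6 7) (Pi.single 6 1 + Pi.single 7 2),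
        twistPerm (swap 1 2) (Pi.single 1 1 + Pi.single 2 1)) := by
  decide +kernel

theorem swap_word :
    ([F, F, F, U, U, F, U].map pairTurn).prod ^ 3 =
      (twistPerm (swap 1 2 * swap 1 4 * swap 1 3) (Pi.single 1 2 + Pi.single 3 1),
        twistPerm (swap 1 2) 0) := by
  decide +kernel

theorem cycle_word :
    ([F, B, F, R, F, F, R].map cornerCycle).prod = List.formPerm [0, 4, 2, 6, 7, 5, 1, 3] := by
  decide +kernel

/-- A full cycle and a transposition of two of its neighbours generate the symmetric group; the
8-cycle of `cycle_word` sends 6 to 7. -/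
theorem closure_cornerCycle : Subgroup.closure (Set.range cornerCycle) = ⊤ := by
  have hmem : ∀ w : List Face,
      (w.map cornerCycle).prod ∈ Subgroup.closure (Set.range cornerCycle) := fun w => by
    refine list_prod_mem fun g hg => ?_
    obtain ⟨X, -, rfl⟩ := List.mem_map.1 hg
    exact Subgroup.subset_closure ⟨X, rfl⟩
  have hs : ([F, U, U, L, B, F, U, R, U].map cornerCycle).prod ^ 9 = swap 6 7 := by
    decide +kernel
  rw [eq_top_iff, ← Perm.closure_cycle_adjacent_swap
    (List.isCycle_formPerm (l := [0, 4, 2, 6, 7, 5, 1, 3]) (by decide) (by decide))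
    (by decide +kernel) (6 : Fin 8), Subgroup.closure_le]
  rintro g (rfl | rfl)
  · exact cycle_word ▸ hmem _
  · have : (List.formPerm [0, 4, 2, 6, 7, 5, 1, 3]) (6 : Fin 8) = 7 := by decide +kernel
    rw [this, ← hs]
    exact pow_mem (hmem _) 9

/-! ### The monoid structure of `twistPerm` -/

section twistPerm

variable {ι A : Type*} [AddCommGroup A]

theorem twistPerm_apply (π : Perm ι) (t : ι → A) (x : ι × A) :
    twistPerm π t x = (π x.1, x.2 + t x.1) := rfl

theorem twistPerm_one_zero : twistPerm (1 : Perm ι) (0 : ι → A) = 1 := by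
  ext x <;> simp [twistPerm_apply]

theorem twistPerm_mul (π ρ : Perm ι) (t s : ι → A) :
    twistPerm π t * twistPerm ρ s = twistPerm (π * ρ) (s + t ∘ ρ) := by
  ext x <;> simp [twistPerm_apply, add_assoc]

theorem twistPerm_inv (π : Perm ι) (t : ι → A) :
    (twistPerm π t)⁻¹ = twistPerm π⁻¹ (-t ∘ ⇑π⁻¹) := by
  rw [inv_eq_iff_mul_eq_one, twistPerm_mul, ← twistPerm_one_zero, mul_inv_cancel]
  congr 1
  ext i
  simp

/-- The sticker permutations of the form `twistPerm π t` with total twist zero. -/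
def zeroTwist (ι A : Type*) [Fintype ι] [AddCommGroup A] : Subgroup (Perm (ι × A)) where
  carrier := {g | ∃ (π : Perm ι) (t : ι → A), ∑ i, t i = 0 ∧ g = twistPerm π t}
  one_mem' := ⟨1, 0, by simp, twistPerm_one_zero.symm⟩
  mul_mem' := by
    rintro _ _ ⟨π, t, ht, rfl⟩ ⟨ρ, s, hs, rfl⟩
    refine ⟨_, _, ?_, twistPerm_mul π ρ t s⟩
    simp [Finset.sum_add_distrib, hs, Equiv.sum_comp ρ t, ht]
  inv_mem' := by
    rintro _ ⟨π, t, ht, rfl⟩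
    refine ⟨_, _, ?_, twistPerm_inv π t⟩
    simpa [Finset.sum_neg_distrib] using (Equiv.sum_comp π⁻¹ t).trans ht

/-- The permutation of the stickers that moves the positions by `π` and carries the distinguished
sticker number `o i` at each position to the distinguished one at its image. -/
def frameLift (o : ι → A) : Perm ι →* Perm (ι × A) where
  toFun π := twistPerm π (o ∘ π - o)
  map_one' := by rw [← twistPerm_one_zero]; congr 1; ext; simp
  map_mul' π ρ := by
    rw [twistPerm_mul]
    congr 1
    ext
    simp

theorem frameLift_apply (o : ι → A) (π : Perm ι) : frameLift o π = twistPerm π (o ∘ π - o) := rfl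

theorem frameLift_apply_frame (o : ι → A) (π : Perm ι) (i : ι) :
    frameLift o π (i, o i) = (π i, o (π i)) := by
  simp [frameLift_apply, twistPerm_apply]

theorem sum_frame_sub [Fintype ι] (o : ι → A) (π : Perm ι) : ∑ i, (o ∘ π - o) i = 0 := by
  simp [Equiv.sum_comp π o]

/-- A map of the form `twistPerm` is determined by the image of one sticker of each cubelet. This
gives the uniqueness of `τ`. -/
theorem eq_frameLift [Fintype ι] {g : Perm (ι × A)} (hg : g ∈ zeroTwist ι A) {o : ι → A}
    {π : Perm ι} (h : ∀ i, g (i, o i) = (π i, o (π i))) : g = frameLift o π := by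
  obtain ⟨ρ, t, -, rfl⟩ := hg
  have hρ : ρ = π := Equiv.ext fun i => congrArg Prod.fst (h i)
  have ht : t = o ∘ π - o := funext fun i =>
    eq_sub_of_add_eq' (congrArg Prod.snd (h i))
  rw [hρ, ht, frameLift_apply]

end twistPerm

theorem G2_le_zeroTwist : G2 ≤ zeroTwist (Fin 8) (ZMod 3) := by
  rw [G2, Subgroup.closure_le]
  rintro _ ⟨X, rfl⟩
  exact ⟨_, _, by revert X; decide +kernel, rfl⟩

theorem edgeAction_mem_zeroTwist (g : G3) : edgeAction g ∈ zeroTwist (Fin 12) (ZMod 2) := by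
  refine (Subgroup.closure_le _).2 ?_ (edgeAction_mem g)
  rintro _ ⟨X, rfl⟩
  exact ⟨_, _, by revert X; decide +kernel, rfl⟩

/-! ### Elements of the cube group that move only corners -/

theorem conj_mem_pairGroup {c k : Perm CornerSticker} {e : Perm EdgeSticker}
    (hc : (c, e) ∈ pairGroup) (hk : (k, 1) ∈ pairGroup) : (c * k * c⁻¹, 1) ∈ pairGroup := by
  simpa using mul_mem (mul_mem hc hk) (inv_mem hc)

/-- Supplies conjugating elements; their uncontrolled edge part cancels in `conj_mem_pairGroup`. -/
theorem exists_mem_pairGroup (π : Perm (Fin 8)) :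
    ∃ t e, (twistPerm π t, e) ∈ pairGroup := by
  have hπ : π ∈ Subgroup.closure (Set.range cornerCycle) := closure_cornerCycle ▸ trivial
  induction hπ using Subgroup.closure_induction with
  | mem x hx =>
    obtain ⟨X, rfl⟩ := hx
    exact ⟨_, _, pairTurn_mem X⟩
  | one => exact ⟨0, 1, by rw [twistPerm_one_zero]; exact one_mem _⟩
  | mul x y _ _ hx hy =>
    obtain ⟨t, e, h⟩ := hx
    obtain ⟨s, f, h'⟩ := hy
    exact ⟨_, _, by simpa [twistPerm_mul] using mul_mem h h'⟩
  | inv x _ hx =>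
    obtain ⟨t, e, h⟩ := hx
    exact ⟨_, _, by simpa [twistPerm_inv] using inv_mem h⟩

/-- The corner twists `t` realized by elements of the cube group that fix the edges. -/
def twistVectors : AddSubgroup (Fin 8 → ZMod 3) where
  carrier := {t | (twistPerm 1 t, 1) ∈ pairGroup}
  zero_mem' := by
    rw [Set.mem_ofPred_eq, twistPerm_one_zero]
    exact one_mem _
  add_mem' {t s} ht hs := by
    have := pairGroup.mul_mem hs ht
    rwa [Prod.mk_mul_mk, twistPerm_mul, one_mul, one_mul] at this
  neg_mem' {t} ht := by
    have := pairGroup.inv_mem ht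
    rwa [Prod.inv_mk, twistPerm_inv, inv_one, inv_one] at this

theorem comp_mem_twistVectors {t : Fin 8 → ZMod 3} (ht : t ∈ twistVectors) (π : Perm (Fin 8)) :
    t ∘ ⇑π⁻¹ ∈ twistVectors := by
  obtain ⟨s, e, h⟩ := exists_mem_pairGroup π
  have := conj_mem_pairGroup h ht
  rw [twistPerm_mul, twistPerm_inv, twistPerm_mul, mul_one, mul_inv_cancel] at this
  -- The twist `s` of the conjugating element cancels because twists commute.
  have e : -s ∘ ⇑π⁻¹ + (t + s ∘ ⇑(1 : Perm (Fin 8))) ∘ ⇑π⁻¹ = t ∘ ⇑π⁻¹ := by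
    ext i
    simp
  rwa [e] at this

theorem single_add_single_mem_twistVectors {i j : Fin 8} (hij : i ≠ j) :
    (Pi.single i 2 + Pi.single j 1 : Fin 8 → ZMod 3) ∈ twistVectors := by
  have h : (Pi.single 1 2 + Pi.single 3 1 : Fin 8 → ZMod 3) ∈ twistVectors :=
    show (_, _) ∈ pairGroup from twist_word ▸ wordPow_mem _ 1
  have hi : swap 1 i 3 ≠ i := fun hi => by
    have := (swap 1 i).injective (hi.trans (swap_apply_left 1 i).symm)
    exact absurd this (by decide)
  -- This permutation sends 1 to `i` and 3 to `j`: the right factor moves 1 to `i`, and by `hi` and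
  -- `hij` the left one leaves `i` in place.
  convert comp_mem_twistVectors h (swap (swap 1 i 3) j * swap 1 i) using 1
  have h1 : (swap (swap 1 i 3) j * swap 1 i) 1 = i := by
    rw [Perm.mul_apply, swap_apply_left, swap_apply_of_ne_of_ne hi.symm hij]
  have h3 : (swap (swap 1 i 3) j * swap 1 i) 3 = j := by
    rw [Perm.mul_apply, swap_apply_left]
  generalize swap (swap 1 i 3) j * swap 1 i = π at h1 h3
  subst h1 h3
  ext k
  simp [Pi.single_apply, symm_apply_eq]

/-- The differences of basis vectors `eᵢ - e₀` generate all vectors of sum zero. -/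
theorem mem_twistVectors {t : Fin 8 → ZMod 3} (ht : ∑ i, t i = 0) : t ∈ twistVectors := by
  have key : ∀ i (a : ZMod 3), (Pi.single i a - Pi.single 0 a : Fin 8 → ZMod 3) ∈ twistVectors := by
    intro i a
    rcases eq_or_ne i 0 with rfl | hi
    · rw [sub_self]
      exact zero_mem _
    · rw [sub_eq_add_neg, ← Pi.single_neg]
      -- In `ZMod 3`, `-1 = 2` and `-2 = 1`, so the nonzero cases are two-corner twists.
      have : a = 0 ∨ a = 1 ∨ a = 2 := by revert a; decide
      rcases this with rfl | rfl | rfl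
      · simp
      · rw [add_comm]
        exact single_add_single_mem_twistVectors hi.symm
      · exact single_add_single_mem_twistVectors hi
  have : t = ∑ i, (Pi.single i (t i) - Pi.single 0 (t i) : Fin 8 → ZMod 3) := by
    rw [Finset.sum_sub_distrib, Finset.univ_sum_single]
    have : ∑ i, (Pi.single 0 (t i) : Fin 8 → ZMod 3) = 0 := by
      rw [← Pi.single_zero (0 : Fin 8), ← ht]
      exact (map_sum (AddMonoidHom.single (fun _ : Fin 8 => ZMod 3) 0) t Finset.univ).symm
    rw [this, sub_zero]
  rw [this]
  exact sum_mem fun i _ => key i (t i)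

/-- The permutations of the corner positions realized by elements of the cube group that fix the
edges. -/
def pureCornerPerms : Subgroup (Perm (Fin 8)) where
  carrier := {π | ∃ t, (twistPerm π t, 1) ∈ pairGroup}
  one_mem' := ⟨0, zero_mem twistVectors⟩
  mul_mem' := by
    rintro π ρ ⟨t, ht⟩ ⟨s, hs⟩
    exact ⟨_, by simpa [twistPerm_mul] using mul_mem ht hs⟩
  inv_mem' := by
    rintro π ⟨t, ht⟩
    exact ⟨_, by simpa [twistPerm_inv] using inv_mem ht⟩

/-- All 3-cycles are conjugate in `S₈`, and conjugation keeps the edge part trivial. -/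
theorem alternatingGroup_le_pureCornerPerms : alternatingGroup (Fin 8) ≤ pureCornerPerms := by
  rw [← Perm.closure_three_cycles_eq_alternating, Subgroup.closure_le]
  intro ρ hρ
  have h0 : (swap 0 2 * swap 0 3 : Perm (Fin 8)).IsThreeCycle :=
    Perm.isThreeCycle_swap_mul_swap_same (by decide) (by decide) (by decide)
  obtain ⟨π, rfl⟩ := isConj_iff.1 (Perm.isConj_iff_cycleType_eq.2 (h0.trans hρ.symm))
  obtain ⟨t, e, h⟩ := exists_mem_pairGroup π
  have := conj_mem_pairGroup h (threeCycle_word ▸ wordPow_mem _ 1)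
  rw [twistPerm_mul, twistPerm_inv, twistPerm_mul] at this
  exact ⟨_, this⟩

theorem twistPerm_mem_pairGroup {π : Perm (Fin 8)} (hπ : Perm.sign π = 1) {t : Fin 8 → ZMod 3}
    (ht : ∑ i, t i = 0) : (twistPerm π t, 1) ∈ pairGroup := by
  obtain ⟨s, hs⟩ := alternatingGroup_le_pureCornerPerms hπ
  -- The twist `s` that comes with `π` has sum zero by the invariant on `G2`, so `t - s` is a
  -- realizable twist.
  have hsum : ∑ i, s i = 0 := by
    obtain ⟨ρ, r, hr, h⟩ := G2_le_zeroTwist (show twistPerm π s ∈ G2 by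
      have := Subgroup.mem_map_of_mem (MonoidHom.fst _ _) hs
      rw [pairGroup, MonoidHom.map_closure, ← Set.range_comp] at this
      exact this)
    have : s = r := funext fun i => by
      simpa [twistPerm_apply] using congrArg Prod.snd (Equiv.congr_fun h (i, 0))
    rw [this, hr]
  have h : t - s ∈ twistVectors := mem_twistVectors (by simp [ht, hsum])
  have := mul_mem hs h
  rw [Prod.mk_mul_mk, twistPerm_mul, mul_one, mul_one] at this
  simpa using this

theorem frameLift_mem_pairGroup (o : LocalFrame) (p : Perm (Fin 8)) :
    (frameLift o.corner p, frameLift o.edge (sigma p)) ∈ pairGroup := by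
  rcases Int.units_eq_one_or (Perm.sign p) with hp | hp
  · have : sigma p = 1 := if_pos hp
    rw [this, map_one]
    exact twistPerm_mem_pairGroup hp (sum_frame_sub _ _)
  · have hσ : sigma p = swap 1 2 := if_neg (by rw [hp]; decide)
    have key : ∃ c : Perm (Fin 8), ∃ t, Perm.sign c = -1 ∧ ∑ i, t i = 0 ∧
        (twistPerm c t, frameLift o.edge (swap 1 2)) ∈ pairGroup := by
      -- Signs vanish in `ZMod 2`, so both swapped edges are flipped by the same amount.
      have he : ∀ a : ZMod 2, o.edge 1 - o.edge 2 = a →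
          o.edge ∘ swap 1 2 - o.edge = ((Pi.single 1 a : Fin 12 → ZMod 2) + (Pi.single 2 a : Fin 12 → ZMod 2)) := by
        rintro a rfl
        ext x
        have h2 : o.edge 2 - o.edge 1 = o.edge 1 - o.edge 2 := by
          generalize o.edge 1 = a
          generalize o.edge 2 = b
          revert a b; decide
        by_cases h1 : x = 1
        · subst h1; simp [h2]
        · by_cases h2 : x = 2
          · subst h2; simp
          · simp [h1, h2, swap_apply_of_ne_of_ne]
      have ha : ∀ a : ZMod 2, a = 0 ∨ a = 1 := by decide
      rcases ha (o.edge 1 - o.edge 2) with h | h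
      · refine ⟨swap 1 2 * swap 1 4 * swap 1 3, Pi.single 1 2 + Pi.single 3 1, ?_, by decide, ?_⟩
        · simp
        · rw [frameLift_apply, he _ h]
          simpa using swap_word ▸ wordPow_mem _ 3
      · refine ⟨swap 6 7, Pi.single 6 1 + Pi.single 7 2, ?_, by decide, ?_⟩
        · simp
        · rw [frameLift_apply, he _ h]
          exact flippedSwap_word ▸ wordPow_mem _ 9
    obtain ⟨c, t, hc, ht, h⟩ := key
    -- Both `c` and `p` are odd, so `c⁻¹ * p` is even and the corners can be corrected without
    -- touching the edges.
    have := mul_mem h (twistPerm_mem_pairGroup (π := c⁻¹ * p)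
      (t := (o.corner ∘ p - o.corner) - t ∘ ⇑(c⁻¹ * p)) (by simp [hc, hp]) (by
        rw [← sum_frame_sub o.corner p, ← sub_zero (∑ i, (o.corner ∘ p - o.corner) i), ← ht,
          ← Equiv.sum_comp (c⁻¹ * p) t, ← Finset.sum_sub_distrib]
        rfl))
    rw [Prod.mk_mul_mk, twistPerm_mul, mul_one, sub_add_cancel, mul_inv_cancel_left] at this
    rwa [hσ]

/-! ### Moves given by pairs of sticker permutations -/

theorem assemble_mem_G3 {c : Perm CornerSticker × Perm EdgeSticker} (hc : c ∈ pairGroup) :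
    assemble c ∈ G3 := by
  have h := Subgroup.mem_map_of_mem assemble hc
  rw [pairGroup, MonoidHom.map_closure, ← Set.range_comp] at h
  exact h

theorem cornerAction_assemble {c : Perm CornerSticker × Perm EdgeSticker} (h : assemble c ∈ G3) :
    cornerAction ⟨assemble c, h⟩ = c.1 :=
  congrArg Prod.fst (components_eq_of_assemble (g := ⟨assemble c, h⟩) rfl)

theorem edgeAction_assemble {c : Perm CornerSticker × Perm EdgeSticker} (h : assemble c ∈ G3) :
    edgeAction ⟨assemble c, h⟩ = c.2 :=
  congrArg Prod.snd (components_eq_of_assemble (g := ⟨assemble c, h⟩) rfl)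

theorem G3_ext {g h : G3} (hc : cornerAction g = cornerAction h)
    (he : edgeAction g = edgeAction h) : g = h := by
  refine Subtype.ext ?_
  rw [← assemble_components g, ← assemble_components h]
  exact congrArg assemble (Prod.ext hc he)

theorem alpha_snd (g : G3) : (alpha g).2 = phi (psi g) := rfl

/-! ### The oriented lift of `S` -/

theorem sigma_eq_of_mem {p : Perm (Fin 12) × Perm (Fin 8)} (hp : p ∈ S) : p.1 = sigma p.2 := by
  obtain ⟨q, rfl⟩ := hp
  rfl

theorem pair_frameLift_mem_pairGroup (o : LocalFrame) {p : Perm (Fin 12) × Perm (Fin 8)}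
    (hp : p ∈ S) : (frameLift o.corner p.2, frameLift o.edge p.1) ∈ pairGroup :=
  sigma_eq_of_mem hp ▸ frameLift_mem_pairGroup o p.2

/-- The lift of `S` to `G3` that preserves local orientation with respect to `o`. -/
def orientedLift (o : LocalFrame) : S →* G3 where
  toFun p := ⟨_, assemble_mem_G3 (pair_frameLift_mem_pairGroup o p.2)⟩
  map_one' := Subtype.ext (by simp [← Prod.one_eq_mk])
  map_mul' p q := Subtype.ext (by simp [← map_mul])

theorem cornerAction_orientedLift (o : LocalFrame) (p : S) :
    cornerAction (orientedLift o p) = frameLift o.corner p.1.2 :=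
  cornerAction_assemble _

theorem edgeAction_orientedLift (o : LocalFrame) (p : S) :
    edgeAction (orientedLift o p) = frameLift o.edge p.1.1 :=
  edgeAction_assemble _

theorem alpha_orientedLift (o : LocalFrame) (p : S) : alpha (orientedLift o p) = p := by
  refine Prod.ext (Equiv.ext fun x => ?_) (Equiv.ext fun i => ?_)
  · exact (alpha_fst_apply _ (x, 0)).trans (by rw [edgeAction_orientedLift]; rfl)
  · exact (alpha_snd_apply _ (i, 0)).trans (by rw [cornerAction_orientedLift]; rfl)

theorem mem_orientationPreserving_iff {o : LocalFrame} {g : G3} :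
    g ∈ orientationPreserving o ↔ cornerAction g = frameLift o.corner (alpha g).2 ∧
      edgeAction g = frameLift o.edge (alpha g).1 := by
  refine (and_congr (cornerOrientation_eq_zero_iff o g) (edgeOrientation_eq_zero_iff o g)).trans
    (and_congr ⟨fun h => ?_, fun h i => ?_⟩ ⟨fun h => ?_, fun h i => ?_⟩)
  · exact eq_frameLift (G2_le_zeroTwist (cornerAction_mem g)) h
  · rw [h, frameLift_apply_frame]
  · exact eq_frameLift (edgeAction_mem_zeroTwist g) h
  · rw [h, frameLift_apply_frame]

theorem isOrientedLift_orientedLift (o : LocalFrame) : IsOrientedLift o (orientedLift o) := by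
  refine fun p => ⟨mem_orientationPreserving_iff.2 ?_, alpha_orientedLift o p⟩
  rw [alpha_orientedLift]
  exact ⟨cornerAction_orientedLift o p, edgeAction_orientedLift o p⟩

theorem IsOrientedLift.eq_orientedLift {o : LocalFrame} {τ : S →* G3} (h : IsOrientedLift o τ) :
    τ = orientedLift o := by
  ext1 p
  have hp := mem_orientationPreserving_iff.1 (h p).1
  rw [(h p).2] at hp
  exact G3_ext (hp.1.trans (cornerAction_orientedLift o p).symm)
    (hp.2.trans (edgeAction_orientedLift o p).symm)

/-! ### The corner twists and the splitting of `ψ` -/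

theorem S_ext {p q : S} (h : p.1.2 = q.1.2) : p = q :=
  Subtype.ext (Prod.ext (by rw [sigma_eq_of_mem p.2, sigma_eq_of_mem q.2, h]) h)

theorem eq_one_of_mem_cornerTwists {l : G3} (hl : l ∈ cornerTwists) (h : psi l = 1) : l = 1 :=
  G3_ext ((congrArg Subtype.val h).trans (map_one cornerAction).symm)
    ((MonoidHom.mem_ker.1 hl.2).trans (map_one edgeAction).symm)

theorem phi_psi_semidirectHom {τ : S →* G3} (hτ : ∀ p, alpha (τ p) = p)
    (x : cornerTwists ⋊[(MulAut.conjNormal (H := cornerTwists)).comp τ] S) :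
    phi (psi (semidirectHom τ x)) = x.right.1.2 := by
  have hl : phi (psi x.left) = 1 := x.left.2.1
  have hx : semidirectHom τ x = x.left * τ x.right := rfl
  rw [hx, map_mul, map_mul, hl, one_mul, ← alpha_snd, hτ]

/-- On the kernel, `φ` forces the `S`-component to be trivial; what remains lies in `L` and acts
trivially on corners and edges. -/
theorem psi_comp_semidirectHom_injective {τ : S →* G3} (hτ : ∀ p, alpha (τ p) = p) :
    Injective (psi.comp (semidirectHom τ)) := by
  refine (injective_iff_map_eq_one _).2 fun x hx => ?_
  rw [MonoidHom.comp_apply] at hx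
  have hr : x.right = 1 := S_ext (by rw [← phi_psi_semidirectHom hτ, hx, map_one]; rfl)
  have hl : semidirectHom τ x = x.left := by
    change (x.left : G3) * τ x.right = x.left
    rw [hr, map_one, mul_one]
  rw [hl] at hx
  exact SemidirectProduct.ext (Subtype.ext (eq_one_of_mem_cornerTwists x.left.2 hx)) hr

/-- An element of the kernel of `φ` is a pure twist of sum zero, hence realizable with all edges
fixed. -/
theorem exists_cornerTwist {g : G2} (hg : phi g = 1) : ∃ l ∈ cornerTwists, psi l = g := by
  obtain ⟨π, t, ht, h⟩ := G2_le_zeroTwist g.2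
  have hπ : π = 1 := by
    rw [← hg]
    ext1 i
    refine Eq.trans ?_ (positionHom_apply (Subgroup.inclusion G2_le_cubeletPerms g) (i, 0)).symm
    change π i = (g.1 (i, 0)).1
    rw [h]
    rfl
  subst hπ
  have hm := assemble_mem_G3 (twistPerm_mem_pairGroup (map_one _) ht)
  have hl : psi ⟨_, hm⟩ = g := Subtype.ext ((cornerAction_assemble hm).trans h.symm)
  exact ⟨⟨_, hm⟩, ⟨(congrArg phi hl).trans hg, edgeAction_assemble hm⟩, hl⟩

theorem psi_comp_semidirectHom_surjective {τ : S →* G3} (hτ : ∀ p, alpha (τ p) = p) :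
    Surjective (psi.comp (semidirectHom τ)) := by
  intro g
  let p : S := ⟨(sigma (phi g), phi g), ⟨phi g, rfl⟩⟩
  have hp : phi (psi (τ p)) = phi g := by rw [← alpha_snd, hτ]
  -- Dividing `g` by the lift of its corner permutation leaves an element of the kernel of `φ`.
  obtain ⟨l, hl, h⟩ := exists_cornerTwist (g := g * (psi (τ p))⁻¹)
    (by rw [map_mul, map_inv, hp, mul_inv_cancel])
  refine ⟨⟨⟨l, hl⟩, p⟩, ?_⟩
  change psi (l * τ p) = g
  rw [map_mul, h, inv_mul_cancel_right]

end RubiksCube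

theorem mainTheorem7 (o : RubiksCube.LocalFrame) :
    RubiksCube.S ≤ RubiksCube.alpha.range ∧
    ∃ τ : RubiksCube.S →* RubiksCube.G3,
      (RubiksCube.IsOrientedLift o τ ∧ ∀ τ', RubiksCube.IsOrientedLift o τ' → τ' = τ) ∧
      Function.Injective (RubiksCube.semidirectHom τ) ∧
      Function.Bijective
        (RubiksCube.psi.comp (RubiksCube.semidirectHom τ).range.subtype) ∧
      ∃ s : RubiksCube.G2 →* RubiksCube.G3,
        RubiksCube.psi.comp s = MonoidHom.id RubiksCube.G2 ∧
        s.range = (RubiksCube.semidirectHom τ).range ∧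
        Function.Injective s := by
  have hα := RubiksCube.alpha_orientedLift o
  have hinj := RubiksCube.psi_comp_semidirectHom_injective hα
  have hsurj := RubiksCube.psi_comp_semidirectHom_surjective hα
  refine ⟨fun p hp => ⟨_, hα ⟨p, hp⟩⟩, RubiksCube.orientedLift o,
    ⟨RubiksCube.isOrientedLift_orientedLift o, fun τ' h => h.eq_orientedLift⟩,
    Function.Injective.of_comp (f := RubiksCube.psi) hinj, ⟨?_, fun g => ?_⟩, ?_⟩
  · rintro ⟨_, x, rfl⟩ ⟨_, y, rfl⟩ h
    exact Subtype.ext (congrArg (RubiksCube.semidirectHom _) (hinj h))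
  · obtain ⟨x, hx⟩ := hsurj g
    exact ⟨⟨_, x, rfl⟩, hx⟩
  -- The section is the inverse of `L ⋊ S ≃ G2` followed by the inclusion into `G3`.
  · let e := MulEquiv.ofBijective _ ⟨hinj, hsurj⟩
    have he : ∀ g, RubiksCube.psi (RubiksCube.semidirectHom (RubiksCube.orientedLift o)
        (e.symm g)) = g := e.apply_symm_apply
    refine ⟨(RubiksCube.semidirectHom _).comp e.symm.toMonoidHom, MonoidHom.ext he, ?_,
      Function.LeftInverse.injective he⟩
    rw [MonoidHom.range_comp, MonoidHom.range_eq_top.2 e.symm.surjective,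
      ← MonoidHom.range_eq_map]
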